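/- Let $\mathbb{D}$ be the open unit disk in $\mathbb{C}$, $\mathbb{T}=\partial\mathbb{D}$, and $m$ normalized Lebesgue measure on $\mathbb{T}$. Let $H^2$ be the space of analytic functions $f$ on $\mathbb{D}$ with $\sup_{0<r<1}\int_{\mathbb{T}}|f(r\xi)|^2\,dm(\xi)<\infty$, and $H^\infty$ the space of bounded analytic functions on $\mathbb{D}$. A function $f\in H^\infty$ is called outer if $$f(z)=\exp\Big(\int_{\mathbb{T}}\frac{\xi+z}{\xi-z}\,\log|f(\xi)|\,dm(\xi)\Big),\qquad z\in\mathbb{D},$$ where $f(\xi)=\lim_{r\to1^-}f(r\xi)$ denotes the radial boundary values of $f$, which exist for almost every $\xi\in\mathbb{T}$, and $\log|f|$ is integrable on $\mathbb{T}$. Let $p$ be a (nonzero) polynomial with complex coefficients all of whose complex roots lie on $\mathbb{T}$. Then for every $h\in H^2$ there exist $u,v\in H^2$ such that $pu\in H^\infty$, $pv\in H^\infty$, $pv+1$ is outer, and $$h=\frac{u}{pv+1}\quad\text{on }\mathbb{D}.$$ -/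

import Mathlib

open Filter Topology

/-- `f` belongs to the Hardy space `H²` of the open unit disk: it is analytic there, and the averages
of `|f|²` over the circles `|z| = r`, `0 < r < 1`, are bounded. Only the values of `f` on the disk
matter. -/
def IsHardyTwo (f : ℂ → ℂ) : Prop :=
  DifferentiableOn ℂ f (Metric.ball 0 1) ∧
    BddAbove ((fun r : ℝ => Real.circleAverage (fun z : ℂ => ‖f z‖ ^ 2) 0 r) '' Set.Ioo 0 1)

/-- `f` belongs to `H^∞`: it is analytic and bounded on the open unit disk. -/
def IsHardyInfty (f : ℂ → ℂ) : Prop :=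
  DifferentiableOn ℂ f (Metric.ball 0 1) ∧ BddAbove ((fun z => ‖f z‖) '' Metric.ball 0 1)

/-- `φ` is the radial boundary function of `f`: at almost every point `ξ` of the unit circle,
`f (r ξ) → φ ξ` as `r → 1` from below. -/
def IsRadialBoundaryFunction (f φ : ℂ → ℂ) : Prop :=
  ∀ᵐ θ : ℝ, Tendsto (fun r : ℝ => f (circleMap 0 r θ)) (𝓝[<] 1) (𝓝 (φ (circleMap 0 1 θ)))

/-- `f` is a bounded outer function: `f ∈ H^∞` and
`f z = exp (∫ (ξ + z) / (ξ - z) * log |f ξ| dm(ξ))` on the disk, where the values `f ξ` on the circle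
are radial limits and `m` is normalized Lebesgue measure. The boundary values are required to be
nonzero almost everywhere and their `log` to be integrable, so that the integral is a true one. -/
def IsOuter (f : ℂ → ℂ) : Prop :=
  IsHardyInfty f ∧
    ∃ φ : ℂ → ℂ, IsRadialBoundaryFunction f φ ∧
      (∀ᵐ θ : ℝ, φ (circleMap 0 1 θ) ≠ 0) ∧
      CircleIntegrable (fun ξ => Real.log ‖φ ξ‖) 0 1 ∧
      ∀ z ∈ Metric.ball (0 : ℂ) 1,
        f z = Complex.exp
          (Real.circleAverage (fun ξ => (ξ + z) / (ξ - z) * (Real.log ‖φ ξ‖ : ℂ)) 0 1)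

/-! Let `g` be the boundary function of `h`, `w = |p g|` on the circle, and `W` the Herglotz
integral of `w`. Then `Re W`, the Poisson integral of `w`, is nonnegative and dominates `|p h|`. So
`exp (-W)` is bounded, and so is `p h exp (-W)`, because `x * exp (-x) ≤ 1` for `x ≥ 0`. The
remaining task is to correct `exp (-W)` to some `F` for which `(F - 1) / p` lies in `H²`.

Put `σ = w / p`. Since `|σ| ≤ |g|`, it is square integrable and its Cauchy integral `k` is in `H²`.
The kernel is `(ξ + z) / (ξ - z) = 1 + 2 z / (ξ - z)`; writing `w = p σ` and splitting `p ξ = (p ξ -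
p z) + p z` gives `W = S + 2 z p k` with `S` a polynomial, because divided differences of `p` are
polynomial in `z`.

Take `F = exp (-W + S) = exp (-2 z p k)`, `u = h F` and `v = (F - 1) / p`. The exponent has real
part bounded above, so `|F - 1| ≤ C |p k|` and `v` is dominated by `k`. That `F` is outer follows
from Fatou's theorem, which gives `log |F| = -w + Re S` almost everywhere on the circle, and from
Schwarz's formula for `S`, where `S 0` is real. -/

open MeasureTheory

/-! ### Normalized arc length and its `L²` space -/

/-- Normalized arc length on the unit circle, as a measure on `ℂ`. -/
noncomputable def circleMeasure : Measure ℂ :=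
  ENNReal.ofReal (2 * Real.pi)⁻¹ •
    (volume.restrict (Set.Ioc 0 (2 * Real.pi))).map (circleMap 0 1)

instance : IsProbabilityMeasure circleMeasure where
  measure_univ := by
    have hpi := Real.two_pi_pos
    rw [circleMeasure, Measure.smul_apply,
      Measure.map_apply (measurable_circleMap 0 1) MeasurableSet.univ]
    simp only [Set.preimage_univ, Measure.restrict_apply_univ, Real.volume_Ioc, sub_zero,
      smul_eq_mul]
    rw [← ENNReal.ofReal_mul (by positivity), inv_mul_cancel₀ hpi.ne', ENNReal.ofReal_one]

theorem ae_circleMeasure_norm_eq_one : ∀ᵐ z ∂circleMeasure, ‖z‖ = 1 := by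
  refine Measure.ae_smul_measure ?_ _
  rw [ae_map_iff (measurable_circleMap 0 1).aemeasurable
    (measurableSet_eq_fun measurable_norm measurable_const)]
  exact ae_of_all _ fun θ => by simp

theorem integral_circleMeasure {E : Type*} [NormedAddCommGroup E] [NormedSpace ℝ E] {f : ℂ → E}
    (hf : StronglyMeasurable f) :
    ∫ z, f z ∂circleMeasure = Real.circleAverage f 0 1 := by
  rw [circleMeasure, integral_smul_measure,
    integral_map (measurable_circleMap 0 1).aemeasurable hf.aestronglyMeasurable,
    Real.circleAverage_def, intervalIntegral.integral_of_le Real.two_pi_pos.le,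
    ENNReal.toReal_ofReal (by have := Real.two_pi_pos; positivity)]

theorem circleIntegrable_of_integrable {E : Type*} [NormedAddCommGroup E] {f : ℂ → E}
    (hm : StronglyMeasurable f) (hf : Integrable f circleMeasure) : CircleIntegrable f 0 1 := by
  have hpi := Real.two_pi_pos
  rw [circleMeasure, integrable_smul_measure (by simpa using Real.pi_pos) (by simp),
    integrable_map_measure hm.aestronglyMeasurable (measurable_circleMap 0 1).aemeasurable] at hf
  rw [CircleIntegrable, intervalIntegrable_iff_integrableOn_Ioc_of_le hpi.le]
  exact hf

theorem memLp_circleMeasure_of_bound {f : ℂ → ℂ} {q : ENNReal} (hm : StronglyMeasurable f) (C : ℝ)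
    (hC : ∀ z, ‖z‖ = 1 → ‖f z‖ ≤ C) : MemLp f q circleMeasure :=
  MemLp.of_bound hm.aestronglyMeasurable C (ae_circleMeasure_norm_eq_one.mono hC)

theorem memLp_pow_circleMeasure {q : ENNReal} (n : ℕ) :
    MemLp (fun z : ℂ => z ^ n) q circleMeasure :=
  memLp_circleMeasure_of_bound (continuous_pow n).stronglyMeasurable 1 fun z hz => by simp [hz]

theorem inner_toLp_toLp {f g : ℂ → ℂ} (hf : MemLp f 2 circleMeasure)
    (hg : MemLp g 2 circleMeasure) :
    inner ℂ (hf.toLp f) (hg.toLp g) = ∫ z, (starRingEnd ℂ) (f z) * g z ∂circleMeasure := by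
  rw [L2.inner_def]
  refine integral_congr_ae ?_
  filter_upwards [hf.coeFn_toLp, hg.coeFn_toLp] with z h1 h2
  rw [h1, h2, RCLike.inner_apply, mul_comm]

theorem norm_toLp_sq {f : ℂ → ℂ} (hf : MemLp f 2 circleMeasure) :
    ‖hf.toLp f‖ ^ 2 = ∫ z, ‖f z‖ ^ 2 ∂circleMeasure := by
  have h := inner_toLp_toLp hf hf
  rw [inner_self_eq_norm_sq_to_K] at h
  have h2 : ∫ z, (starRingEnd ℂ) (f z) * f z ∂circleMeasure
      = ((∫ z, ‖f z‖ ^ 2 ∂circleMeasure : ℝ) : ℂ) := by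
    rw [← integral_complex_ofReal]
    exact integral_congr_ae (ae_of_all _ fun z => by simp [Complex.conj_mul'])
  rw [h2] at h
  exact Complex.ofReal_injective (by simpa using h)

/-- The monomial `z ^ n` as an element of `L²` of the circle. -/
noncomputable def monomialLp (n : ℕ) : Lp ℂ 2 circleMeasure := (memLp_pow_circleMeasure n).toLp _

theorem integral_pow_circleMeasure {n : ℕ} (hn : n ≠ 0) :
    ∫ z : ℂ, z ^ n ∂circleMeasure = 0 := by
  rw [integral_circleMeasure (continuous_pow n).stronglyMeasurable, DiffContOnCl.circleAverage]
  · simp [hn]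
  · exact (differentiable_pow n).diffContOnCl

/-- On the circle `conj (z ^ m) * z ^ n = z ^ (n - m)` for `m < n`, whose mean is its value at `0`.
-/
theorem orthonormal_monomialLp : Orthonormal ℂ monomialLp := by
  have key : ∀ m n : ℕ, m < n → inner ℂ (monomialLp m) (monomialLp n) = 0 := by
    intro m n hmn
    rw [monomialLp, monomialLp, inner_toLp_toLp,
      ← integral_pow_circleMeasure (Nat.sub_ne_zero_of_lt hmn)]
    refine integral_congr_ae ?_
    filter_upwards [ae_circleMeasure_norm_eq_one] with z hz
    obtain ⟨k, rfl⟩ := Nat.exists_eq_add_of_lt hmn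
    rw [show m + k + 1 - m = k + 1 by lia, show m + k + 1 = m + (k + 1) by lia, pow_add, ← mul_assoc,
      map_pow, ← mul_pow, Complex.conj_mul', hz]
    simp
  refine ⟨fun n => ?_, fun m n hmn => ?_⟩
  · have h : ‖monomialLp n‖ ^ 2 = 1 := by
      rw [monomialLp, norm_toLp_sq]
      have : ∫ z : ℂ, ‖z ^ n‖ ^ 2 ∂circleMeasure = ∫ _, (1 : ℝ) ∂circleMeasure := by
        refine integral_congr_ae ?_
        filter_upwards [ae_circleMeasure_norm_eq_one] with z hz
        simp [hz]
      rw [this]; simp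
    exact (pow_eq_one_iff_of_nonneg (norm_nonneg _) two_ne_zero).1 h
  · rcases lt_or_gt_of_ne hmn with h | h
    · exact key m n h
    · rw [← inner_conj_symm, key n m h, map_zero]

theorem summable_smul_monomialLp {a : ℕ → ℂ} (ha : Summable fun n => ‖a n‖ ^ 2) :
    Summable fun n => a n • monomialLp n :=
  (orthonormal_monomialLp.orthogonalFamily.summable_iff_norm_sq_summable a).2 ha

theorem norm_sum_smul_monomialLp (a : ℕ → ℂ) (s : Finset ℕ) :
    ‖∑ n ∈ s, a n • monomialLp n‖ ^ 2 = ∑ n ∈ s, ‖a n‖ ^ 2 :=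
  orthonormal_monomialLp.orthogonalFamily.norm_sum a s

/-! ### `H²` in terms of Taylor coefficients -/

theorem summable_norm_mul_pow {a : ℕ → ℂ} {f : ℂ → ℂ}
    (hf : ∀ z ∈ Metric.ball (0 : ℂ) 1, HasSum (fun n => a n * z ^ n) (f z))
    {r : ℝ} (h0 : 0 ≤ r) (h1 : r < 1) : Summable fun n => ‖a n‖ * r ^ n := by
  have h := (hf (r : ℂ) (by simp [abs_of_nonneg h0, h1])).summable.norm
  simpa [abs_of_nonneg h0] using h

/-- Parseval's identity on the circle of radius `r`. -/
theorem hasSum_circleAverage_norm_sq {a : ℕ → ℂ} {f : ℂ → ℂ}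
    (hf : ∀ z ∈ Metric.ball (0 : ℂ) 1, HasSum (fun n => a n * z ^ n) (f z))
    {r : ℝ} (h0 : 0 ≤ r) (h1 : r < 1) :
    HasSum (fun n => (‖a n‖ * r ^ n) ^ 2) (Real.circleAverage (fun z => ‖f z‖ ^ 2) 0 r) := by
  have hs := summable_norm_mul_pow hf h0 h1
  set b : ℕ → ℂ := fun n => a n * r ^ n with hb
  have hbn : ∀ n, ‖b n‖ = ‖a n‖ * r ^ n := fun n => by simp [hb, abs_of_nonneg h0]
  simp_rw [← hbn] at hs ⊢
  -- Defined by the series at every point, `g` is measurable on all of `ℂ`; on the unit circle it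
  -- agrees with `z ↦ f (r z)`.
  set g : ℂ → ℂ := fun z => ∑' n, b n * z ^ n with hg
  have hgz : ∀ z, ‖z‖ = 1 → HasSum (fun n => b n * z ^ n) (f (r * z)) := by
    intro z hz
    have := hf (r * z) (by simpa [abs_of_nonneg h0, hz] using h1)
    refine this.congr_fun fun n => ?_
    simp [hb, mul_pow, mul_assoc]
  have hgm : StronglyMeasurable g := by
    refine Measurable.stronglyMeasurable ?_
    exact Measurable.tsum fun n => (by fun_prop)
  have hgb : ∀ z, ‖z‖ = 1 → ‖g z‖ ≤ ∑' n, ‖b n‖ := by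
    intro z hz
    refine (norm_tsum_le_tsum_norm ?_).trans_eq ?_
    · simpa [hz] using hs
    · simp [hz]
  have hgL : MemLp g 2 circleMeasure := memLp_circleMeasure_of_bound hgm _ hgb
  have hlim : Tendsto (fun N => ∑ n ∈ Finset.range N, b n • monomialLp n) atTop
      (𝓝 (hgL.toLp g)) := by
    -- For a probability measure the `L²` norm is at most the essential supremum, here a tail of `∑
    -- ‖b n‖`.
    rw [tendsto_iff_norm_sub_tendsto_zero]
    refine squeeze_zero (fun _ => norm_nonneg _) (fun N => ?_)
      (tendsto_sum_nat_add fun n => ‖b n‖)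
    have h := Lp.norm_le_of_ae_bound (p := 2) (μ := circleMeasure)
      (f := ∑ n ∈ Finset.range N, b n • monomialLp n - hgL.toLp g)
      (C := ∑' n, ‖b (n + N)‖) (tsum_nonneg fun _ => norm_nonneg _) ?_
    · simpa [measureUnivNNReal] using h
    have hsum : ∀ᵐ z ∂circleMeasure, (∑ n ∈ Finset.range N, b n • monomialLp n : Lp ℂ 2 circleMeasure) z
        = ∑ n ∈ Finset.range N, b n * z ^ n := by
      have h1 : ∀ᵐ z ∂circleMeasure, ∀ n : ℕ, (b n • monomialLp n : Lp ℂ 2 circleMeasure) z = b n * z ^ n := by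
        rw [ae_all_iff]
        intro n
        filter_upwards [Lp.coeFn_smul (b n) (monomialLp n),
          (memLp_pow_circleMeasure (q := 2) n).coeFn_toLp] with z h2 h3
        rw [h2, Pi.smul_apply, smul_eq_mul, monomialLp, h3]
      filter_upwards [h1, Lp.coeFn_finsetSum (Finset.range N) fun n => b n • monomialLp n] with z h2 h3
      rw [h3]
      simp [h2]
    filter_upwards [hsum, Lp.coeFn_sub (∑ n ∈ Finset.range N, b n • monomialLp n) (hgL.toLp g),
      hgL.coeFn_toLp, ae_circleMeasure_norm_eq_one] with z h2 h3 h4 hz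
    rw [h3, Pi.sub_apply, h2, h4, hg]
    have h5 : Summable fun n => b n * z ^ n := (hgz z hz).summable
    have h6 : Summable fun n => ‖b (n + N) * z ^ (n + N)‖ := by
      simpa [hz] using (summable_nat_add_iff N).2 hs
    dsimp only
    rw [← h5.sum_add_tsum_nat_add N, sub_add_cancel_left, norm_neg]
    refine (norm_tsum_le_tsum_norm h6).trans_eq ?_
    simp [hz]
  have hnorm : Tendsto (fun N => ∑ n ∈ Finset.range N, ‖b n‖ ^ 2) atTop
      (𝓝 (‖hgL.toLp g‖ ^ 2)) := by
    simp_rw [← norm_sum_smul_monomialLp]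
    exact hlim.norm.pow 2
  have heq : Real.circleAverage (fun z => ‖f z‖ ^ 2) 0 r = ‖hgL.toLp g‖ ^ 2 := by
    rw [norm_toLp_sq, integral_circleMeasure (f := fun z => ‖g z‖ ^ 2) (hgm.norm.pow 2),
      Real.circleAverage_eq_circleAverage_zero_one]
    refine Real.circleAverage_congr_sphere fun z hz => ?_
    have hz' : ‖z‖ = 1 := by simpa using hz
    simp [hg, (hgz z hz').tsum_eq]
  rw [heq]
  exact (hasSum_iff_tendsto_nat_of_nonneg (fun _ => by positivity) _).2 hnorm

/-- Parseval bounds each finite partial sum uniformly in `r`, and a finite sum allows `r → 1`. -/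
theorem IsHardyTwo.exists_hasSum {f : ℂ → ℂ} (hf : IsHardyTwo f) :
    ∃ a : ℕ → ℂ, (Summable fun n => ‖a n‖ ^ 2) ∧
      ∀ z ∈ Metric.ball (0 : ℂ) 1, HasSum (fun n => a n * z ^ n) (f z) := by
  obtain ⟨hd, M, hM⟩ := hf
  set a : ℕ → ℂ := fun n => (n.factorial : ℂ)⁻¹ * iteratedDeriv n f 0 with ha
  have hsum : ∀ z ∈ Metric.ball (0 : ℂ) 1, HasSum (fun n => a n * z ^ n) (f z) := by
    intro z hz
    refine (Complex.hasSum_taylorSeries_on_ball hd hz).congr_fun fun n => ?_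
    simp [ha]; ring
  refine ⟨a, summable_of_sum_range_le (c := M) (fun _ => by positivity) fun N => ?_, hsum⟩
  have hb : ∀ r ∈ Set.Ioo (0 : ℝ) 1, ∑ n ∈ Finset.range N, (‖a n‖ * r ^ n) ^ 2 ≤ M := by
    intro r hr
    have h := hasSum_circleAverage_norm_sq hsum hr.1.le hr.2
    exact (sum_le_hasSum _ (fun _ _ => by positivity) h).trans (hM ⟨r, hr, rfl⟩)
  have hc : Tendsto (fun r : ℝ => ∑ n ∈ Finset.range N, (‖a n‖ * r ^ n) ^ 2) (𝓝[<] 1)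
      (𝓝 (∑ n ∈ Finset.range N, (‖a n‖ * 1 ^ n) ^ 2)) := by
    refine Tendsto.mono_left (Continuous.tendsto ?_ 1) nhdsWithin_le_nhds
    fun_prop
  have := le_of_tendsto hc (Filter.mem_of_superset (Ioo_mem_nhdsLT zero_lt_one) hb)
  simpa using this

theorem isHardyTwo_of_hasSum {f : ℂ → ℂ} {a : ℕ → ℂ} (ha : Summable fun n => ‖a n‖ ^ 2)
    (hf : ∀ z ∈ Metric.ball (0 : ℂ) 1, HasSum (fun n => a n * z ^ n) (f z)) : IsHardyTwo f := by
  refine ⟨?_, ∑' n, ‖a n‖ ^ 2, ?_⟩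
  · have h : HasFPowerSeriesOnBall f (FormalMultilinearSeries.ofScalars ℂ a) 0 1 := by
      refine ⟨?_, zero_lt_one, ?_⟩
      · refine ENNReal.le_of_forall_nnreal_lt fun r hr => ?_
        have hr' : (r : ℝ) < 1 := by exact_mod_cast hr
        refine FormalMultilinearSeries.le_radius_of_summable_norm _ ?_
        refine (summable_norm_mul_pow hf r.2 hr').congr fun n => ?_
        simp
      · intro y hy
        have hy' : y ∈ Metric.ball (0 : ℂ) 1 := by
          rw [← Metric.eball_ofReal]
          simpa using hy
        simpa [FormalMultilinearSeries.ofScalars_apply_eq, mul_comm] using hf y hy'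
    have := h.differentiableOn
    rwa [← ENNReal.ofReal_one, Metric.eball_ofReal] at this
  · rintro _ ⟨r, hr, rfl⟩
    have h := hasSum_circleAverage_norm_sq hf hr.1.le hr.2
    dsimp only
    rw [← h.tsum_eq]
    refine h.summable.tsum_le_tsum (fun n => ?_) ha
    rw [mul_pow]
    refine mul_le_of_le_one_right (by positivity) ?_
    exact pow_le_one₀ (by have := hr.1; positivity) (pow_le_one₀ hr.1.le hr.2.le)

/-! ### Boundary functions and Poisson representation -/

/-- The boundary function is the `L²` sum of the series. It is used only through its pairings, here
the inner products with `conj K`, so no pointwise convergence on the circle is needed. -/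
theorem exists_boundary_hasSum {a : ℕ → ℂ} (ha : Summable fun n => ‖a n‖ ^ 2) :
    ∃ g : ℂ → ℂ, StronglyMeasurable g ∧ MemLp g 2 circleMeasure ∧
      ∀ K : ℂ → ℂ, MemLp K 2 circleMeasure →
        HasSum (fun n => a n * ∫ z, K z * z ^ n ∂circleMeasure) (∫ z, K z * g z ∂circleMeasure) := by
  obtain ⟨G, hG⟩ := summable_smul_monomialLp ha
  refine ⟨G, Lp.stronglyMeasurable G, Lp.memLp G, fun K hK => ?_⟩
  have h := hG.mapL (innerSL ℂ (hK.star.toLp (star K)))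
  have hGe : (Lp.memLp G).toLp G = G := Lp.toLp_coeFn _ _
  rw [← hGe] at h
  simp only [innerSL_apply_apply, inner_smul_right, monomialLp, inner_toLp_toLp, Pi.star_apply,
    RCLike.star_def, Complex.conj_conj] at h
  exact h

theorem sub_ne_zero_of_norm_eq_one {z ξ : ℂ} (hz : ‖z‖ < 1) (hξ : ‖ξ‖ = 1) : ξ - z ≠ 0 := by
  intro h
  rw [sub_eq_zero] at h
  rw [← h, hξ] at hz
  exact lt_irrefl _ hz

theorem one_sub_norm_le {z ξ : ℂ} (hξ : ‖ξ‖ = 1) : 1 - ‖z‖ ≤ ‖ξ - z‖ := by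
  simpa [hξ] using norm_sub_norm_le ξ z

theorem poissonKernel_nonneg {z ξ : ℂ} (hz : ‖z‖ < 1) (hξ : ‖ξ‖ = 1) :
    0 ≤ poissonKernel 0 z ξ := by
  rw [poissonKernel_def]
  refine div_nonneg ?_ (by positivity)
  simp only [sub_zero, hξ]
  nlinarith [norm_nonneg z]

theorem poissonKernel_le {z ξ : ℂ} (hz : ‖z‖ < 1) (hξ : ‖ξ‖ = 1) :
    poissonKernel 0 z ξ ≤ 1 / (1 - ‖z‖) ^ 2 := by
  rw [poissonKernel_def]
  simp only [sub_zero, hξ]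
  have h1 := one_sub_norm_le (z := z) hξ
  have h2 : 0 < 1 - ‖z‖ := by linarith
  gcongr
  nlinarith [norm_nonneg z]

@[fun_prop]
theorem measurable_poissonKernel (z : ℂ) : Measurable (poissonKernel 0 z) := by
  unfold poissonKernel
  fun_prop

/-- The Poisson integral over the unit circle. -/
noncomputable def poissonIntegral (g : ℂ → ℂ) (z : ℂ) : ℂ :=
  Real.circleAverage (fun ξ => (poissonKernel 0 z ξ : ℂ) * g ξ) 0 1

/-- Every `f ∈ H²` is represented, after multiplication by any polynomial, as a Poisson integral
of its boundary function. -/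
theorem IsHardyTwo.exists_boundary {f : ℂ → ℂ} (hf : IsHardyTwo f) :
    ∃ g : ℂ → ℂ, StronglyMeasurable g ∧ MemLp g 2 circleMeasure ∧
      ∀ p : Polynomial ℂ, ∀ z ∈ Metric.ball (0 : ℂ) 1,
        poissonIntegral (fun ξ => p.eval ξ * g ξ) z = p.eval z * f z := by
  obtain ⟨a, ha, hsum⟩ := hf.exists_hasSum
  obtain ⟨g, hgm, hgL, hg⟩ := exists_boundary_hasSum ha
  refine ⟨g, hgm, hgL, fun p z hz => ?_⟩
  have hz' : ‖z‖ < 1 := by simpa using hz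
  obtain ⟨C, hC⟩ := (isCompact_sphere (0 : ℂ) 1).exists_bound_of_continuousOn
    p.continuous.continuousOn
  have hKm : Measurable fun ξ => (poissonKernel 0 z ξ : ℂ) * p.eval ξ :=
    (Complex.measurable_ofReal.comp (measurable_poissonKernel z)).mul p.continuous.measurable
  have hK : MemLp (fun ξ => (poissonKernel 0 z ξ : ℂ) * p.eval ξ) 2 circleMeasure := by
    refine memLp_circleMeasure_of_bound hKm.stronglyMeasurable (1 / (1 - ‖z‖) ^ 2 * C)
      fun ξ hξ => ?_
    rw [norm_mul, Complex.norm_real, Real.norm_of_nonneg (poissonKernel_nonneg hz' hξ)]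
    exact mul_le_mul (poissonKernel_le hz' hξ) (hC ξ (by simpa using hξ)) (norm_nonneg _)
      (by positivity)
  have h := hg _ hK
  -- The Poisson integral reproduces the analytic polynomial `p ξ * ξ ^ n`.
  have hn : ∀ n : ℕ, ∫ ξ, (poissonKernel 0 z ξ : ℂ) * p.eval ξ * ξ ^ n ∂circleMeasure
      = p.eval z * z ^ n := by
    intro n
    rw [integral_circleMeasure (f := fun ξ => (poissonKernel 0 z ξ : ℂ) * p.eval ξ * ξ ^ n)
      (hKm.mul (by fun_prop)).stronglyMeasurable]
    have hd : Differentiable ℂ fun ξ : ℂ => p.eval ξ * ξ ^ n :=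
      p.differentiable.mul (differentiable_pow n)
    rw [← DiffContOnCl.circleAverage_poissonKernel_smul hd.diffContOnCl hz]
    refine Real.circleAverage_congr_sphere fun ξ _ => ?_
    simp [mul_assoc]
  simp_rw [hn] at h
  rw [integral_circleMeasure (f := fun ξ => (poissonKernel 0 z ξ : ℂ) * p.eval ξ * g ξ)
    (hKm.stronglyMeasurable.mul hgm)] at h
  have h2 : HasSum (fun n => a n * (p.eval z * z ^ n)) (p.eval z * f z) :=
    ((hsum z hz).mul_left (p.eval z)).congr_fun fun n => by ring
  rw [← h.unique h2, poissonIntegral]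
  simp_rw [mul_assoc]

/-! ### Cauchy integrals, Schwarz's formula, divided differences -/

/-- The Cauchy integral of a square integrable function belongs to `H²`. -/
theorem isHardyTwo_cauchyIntegral {σ : ℂ → ℂ} (hm : StronglyMeasurable σ)
    (hσ : MemLp σ 2 circleMeasure) :
    IsHardyTwo fun z => Real.circleAverage (fun ξ => σ ξ / (ξ - z)) 0 1 := by
  -- The shift comes from `1 / (ξ - z) = ∑ z ^ n * ξ⁻¹ ^ (n + 1)`; Bessel's inequality makes the
  -- coefficients square summable.
  set c : ℕ → ℂ := fun n => inner ℂ (monomialLp (n + 1)) (hσ.toLp σ) with hc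
  have hcs : Summable fun n => ‖c n‖ ^ 2 :=
    (summable_nat_add_iff (f := fun n => ‖inner ℂ (monomialLp n) (hσ.toLp σ)‖ ^ 2) 1).2
      (orthonormal_monomialLp.inner_products_summable (hσ.toLp σ))
  have hint : Integrable σ circleMeasure := hσ.integrable (by norm_num)
  refine isHardyTwo_of_hasSum hcs fun z hz => ?_
  have hz' : ‖z‖ < 1 := by simpa using hz
  have hci : ∀ n, c n * z ^ n = ∫ ξ, z ^ n * ((starRingEnd ℂ) (ξ ^ (n + 1)) * σ ξ) ∂circleMeasure := by
    intro n
    rw [integral_const_mul, hc, mul_comm]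
    simp only [monomialLp, inner_toLp_toLp]
  have hF : ∀ n : ℕ, Integrable
      (fun ξ => z ^ n * ((starRingEnd ℂ) (ξ ^ (n + 1)) * σ ξ)) circleMeasure := by
    intro n
    refine Integrable.const_mul ?_ _
    refine hint.bdd_mul (c := 1) ?_ ?_
    · exact (Complex.continuous_conj.comp (continuous_pow (n + 1))).aestronglyMeasurable
    · filter_upwards [ae_circleMeasure_norm_eq_one] with ξ hξ
      simp [hξ]
  have hN : ∀ n : ℕ, ∫ ξ, ‖z ^ n * ((starRingEnd ℂ) (ξ ^ (n + 1)) * σ ξ)‖ ∂circleMeasure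
      = ‖z‖ ^ n * ∫ ξ, ‖σ ξ‖ ∂circleMeasure := by
    intro n
    rw [← integral_const_mul]
    refine integral_congr_ae ?_
    filter_upwards [ae_circleMeasure_norm_eq_one] with ξ hξ
    simp [hξ]
  have h := hasSum_integral_of_summable_integral_norm hF (by
    simp_rw [hN]
    exact (summable_geometric_of_lt_one (norm_nonneg _) hz').mul_right _)
  simp_rw [← hci] at h
  have hm' : StronglyMeasurable fun ξ => σ ξ / (ξ - z) := by
    refine (hm.measurable.div ?_).stronglyMeasurable
    fun_prop
  refine (congrArg (HasSum _) ?_).mp h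
  rw [← integral_circleMeasure hm']
  symm
  refine integral_congr_ae ?_
  filter_upwards [ae_circleMeasure_norm_eq_one] with ξ hξ
  have hξ0 : ξ ≠ 0 := by rintro rfl; simp at hξ
  have hconj : (starRingEnd ℂ) ξ = ξ⁻¹ := by
    rw [Complex.inv_def, Complex.normSq_eq_norm_sq, hξ]; simp
  have hgeo : HasSum (fun n : ℕ => (z / ξ) ^ n) (1 - z / ξ)⁻¹ :=
    hasSum_geometric_of_norm_lt_one (by simpa [hξ] using hz')
  have h3 := (hgeo.mul_left (ξ⁻¹ * σ ξ)).tsum_eq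
  have h4 : σ ξ / (ξ - z) = ξ⁻¹ * σ ξ * (1 - z / ξ)⁻¹ := by
    have := sub_ne_zero_of_norm_eq_one hz' hξ
    have h5 : 1 - z / ξ = (ξ - z) / ξ := by field_simp
    rw [h5]; field_simp
  rw [h4, ← h3]
  refine tsum_congr fun n => ?_
  rw [map_pow, hconj, div_pow, pow_succ, inv_pow]
  field_simp

theorem circleIntegrable_div_sub_mul {g : ℂ → ℂ} (hg : CircleIntegrable g 0 1) {z : ℂ}
    (hz : ‖z‖ < 1) {N : ℂ → ℂ} (hN : Continuous N) :
    CircleIntegrable (fun ξ => N ξ / (ξ - z) * g ξ) 0 1 := by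
  refine hg.continuousOn_smul (g := fun ξ => N ξ / (ξ - z)) ?_
  refine hN.continuousOn.div (by fun_prop) fun ξ hξ => ?_
  exact sub_ne_zero_of_norm_eq_one hz (by simpa using hξ)

/-- Schwarz's formula on the unit disk for polynomials. -/
theorem Polynomial.circleAverage_herglotz_re (S : Polynomial ℂ) (hS : (S.eval 0).im = 0) {z : ℂ}
    (hz : ‖z‖ < 1) :
    Real.circleAverage (fun ξ => (ξ + z) / (ξ - z) * ((S.eval ξ).re : ℂ)) 0 1 = S.eval z := by
  have hSc : CircleIntegrable (fun ξ => S.eval ξ) 0 1 :=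
    S.continuous.continuousOn.circleIntegrable zero_le_one
  have hzb : z ∈ Metric.ball (0 : ℂ) |1| := by simpa using hz
  have hA : Real.circleAverage (fun ξ => ξ / (ξ - z) * S.eval ξ) 0 1 = S.eval z := by
    have := (S.differentiable.diffContOnCl (s := Metric.ball (0 : ℂ) |1|)).circleAverage_smul_div hzb
    simpa using this
  have hA0 : Real.circleAverage (fun ξ => S.eval ξ) 0 1 = S.eval 0 :=
    (S.differentiable.diffContOnCl (s := Metric.ball (0 : ℂ) |1|)).circleAverage
  -- On the circle `conj T` equals `(ξ + z) / (ξ - z) * conj S`, while `T` is analytic on the closed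
  -- disk, so its mean is `T 0 = S 0`.
  set T : ℂ → ℂ := fun ξ => (1 + (starRingEnd ℂ) z * ξ) / (1 - (starRingEnd ℂ) z * ξ) * S.eval ξ
    with hT
  have hne : ∀ ξ ∈ Metric.closedBall (0 : ℂ) 1, 1 - (starRingEnd ℂ) z * ξ ≠ 0 := by
    intro ξ hξ h
    have h1 : ‖(starRingEnd ℂ) z * ξ‖ = 1 := by
      rw [← sub_eq_zero.1 h]; simp
    have h2 : ‖ξ‖ ≤ 1 := by simpa using hξ
    rw [norm_mul, RCLike.norm_conj] at h1
    nlinarith [norm_nonneg z, norm_nonneg ξ]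
  have hTd : DifferentiableOn ℂ T (Metric.closedBall 0 1) := by
    refine DifferentiableOn.mul ?_ S.differentiable.differentiableOn
    exact DifferentiableOn.div (by fun_prop) (by fun_prop) hne
  have hTc : CircleIntegrable T 0 1 :=
    (hTd.continuousOn.mono Metric.sphere_subset_closedBall).circleIntegrable zero_le_one
  have hB : Real.circleAverage T 0 1 = S.eval 0 := by
    have h : DiffContOnCl ℂ T (Metric.ball 0 |1|) := by
      refine DifferentiableOn.diffContOnCl ?_
      rwa [abs_one, closure_ball 0 one_ne_zero]
    rw [h.circleAverage]
    simp [hT]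
  have hBc : Real.circleAverage (fun ξ => (starRingEnd ℂ) (T ξ)) 0 1 = S.eval 0 := by
    have h := (Complex.conjCLE : ℂ →L[ℝ] ℂ).circleAverage_comp_comm hTc
    rw [hB] at h
    have h0 : (starRingEnd ℂ) (S.eval 0) = S.eval 0 := Complex.conj_eq_iff_im.2 hS
    simpa [Function.comp_def, h0] using h
  have hTc' : CircleIntegrable (fun ξ => (starRingEnd ℂ) (T ξ)) 0 1 := by
    refine ContinuousOn.circleIntegrable zero_le_one ?_
    exact Complex.continuous_conj.comp_continuousOn
      (hTd.continuousOn.mono Metric.sphere_subset_closedBall)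
  have hAc : CircleIntegrable (fun ξ => ξ / (ξ - z) * S.eval ξ) 0 1 :=
    circleIntegrable_div_sub_mul hSc hz continuous_id
  -- Write `Re S = (S + conj S) / 2` and `(ξ + z) / (2 (ξ - z)) = ξ / (ξ - z) - 1 / 2`. The means of
  -- `conj T` and `S` are both `S 0` and cancel.
  have hcongr : Real.circleAverage (fun ξ => (ξ + z) / (ξ - z) * ((S.eval ξ).re : ℂ)) 0 1
      = Real.circleAverage (fun ξ => (ξ / (ξ - z) * S.eval ξ)
        + (2⁻¹ : ℂ) • ((starRingEnd ℂ) (T ξ) - S.eval ξ)) 0 1 := by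
    refine Real.circleAverage_congr_sphere fun ξ hξ => ?_
    have hξ1 : ‖ξ‖ = 1 := by simpa using hξ
    have hξ0 : ξ ≠ 0 := by rintro rfl; simp at hξ1
    have hconj : (starRingEnd ℂ) ξ = ξ⁻¹ := by
      rw [Complex.inv_def, Complex.normSq_eq_norm_sq, hξ1]; simp
    have h1 := sub_ne_zero_of_norm_eq_one hz hξ1
    have h2 : (1 + z * ξ⁻¹) / (1 - z * ξ⁻¹) = (ξ + z) / (ξ - z) := by
      have : 1 - z * ξ⁻¹ = (ξ - z) / ξ := by field_simp
      rw [this]; field_simp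
    simp only [hT, map_mul, map_div₀, map_add, map_sub, map_one, Complex.conj_conj, hconj, h2,
      Complex.re_eq_add_conj, smul_eq_mul]
    field_simp
    ring
  rw [hcongr, Real.circleAverage_fun_add hAc ((hTc'.fun_sub hSc).const_fun_smul), Real.circleAverage_fun_smul,
    Real.circleAverage_fun_sub hTc' hSc, hA, hBc, hA0]
  simp

/-- Integrating the divided difference of a polynomial in one of its variables gives a polynomial
in the other. -/
theorem Polynomial.exists_circleAverage_dividedDifference {σ : ℂ → ℂ} (hσ : CircleIntegrable σ 0 1)
    (p : Polynomial ℂ) :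
    ∃ q : Polynomial ℂ, ∀ z : ℂ, ‖z‖ < 1 →
      Real.circleAverage (fun ξ => (p.eval ξ - p.eval z) / (ξ - z) * σ ξ) 0 1 = q.eval z := by
  induction p using Polynomial.induction_on' with
  | add p₁ p₂ h₁ h₂ =>
    obtain ⟨q₁, h₁⟩ := h₁
    obtain ⟨q₂, h₂⟩ := h₂
    refine ⟨q₁ + q₂, fun z hz => ?_⟩
    rw [Polynomial.eval_add (p := q₁), ← h₁ z hz, ← h₂ z hz, ← Real.circleAverage_fun_add
      (circleIntegrable_div_sub_mul hσ hz (by fun_prop))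
      (circleIntegrable_div_sub_mul hσ hz (by fun_prop))]
    congr 1
    ext ξ
    simp only [Polynomial.eval_add]
    ring
  | monomial n a =>
    refine ⟨∑ i ∈ Finset.range n, Polynomial.C (Real.circleAverage (fun ξ => a * ξ ^ i * σ ξ) 0 1)
      * Polynomial.X ^ (n - 1 - i), fun z hz => ?_⟩
    have hc : ∀ i : ℕ, CircleIntegrable (fun ξ => a * ξ ^ i * σ ξ) 0 1 := fun i =>
      hσ.continuousOn_smul (g := fun ξ => a * ξ ^ i) (by fun_prop)
    have h : Real.circleAverage (fun ξ => ((Polynomial.monomial n a).eval ξ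
        - (Polynomial.monomial n a).eval z) / (ξ - z) * σ ξ) 0 1
        = Real.circleAverage (fun ξ => ∑ i ∈ Finset.range n,
          z ^ (n - 1 - i) • (a * ξ ^ i * σ ξ)) 0 1 := by
      refine Real.circleAverage_congr_sphere fun ξ hξ => ?_
      have h1 := sub_ne_zero_of_norm_eq_one hz (ξ := ξ) (by simpa using hξ)
      have h2 := (Commute.all ξ z).geom_sum₂_mul n
      simp only [Polynomial.eval_monomial]
      rw [← mul_sub, ← h2, ← mul_assoc, mul_div_cancel_right₀ _ h1, Finset.mul_sum, Finset.sum_mul]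
      refine Finset.sum_congr rfl fun i _ => ?_
      rw [smul_eq_mul]; ring
    rw [h, Real.circleAverage_fun_sum fun i _ => (hc i).const_fun_smul, Polynomial.eval_finsetSum]
    refine Finset.sum_congr rfl fun i _ => ?_
    rw [Real.circleAverage_fun_smul]
    simp only [smul_eq_mul, Polynomial.eval_mul, Polynomial.eval_C, Polynomial.eval_pow,
      Polynomial.eval_X]
    exact mul_comm _ _

/-! ### Fatou's theorem -/

/-- The Poisson kernel of the unit disk as a function of the radius and the angle. -/
noncomputable def anglePoissonKernel (r t : ℝ) : ℝ :=
  (1 - r ^ 2) / (1 - 2 * r * Real.cos t + r ^ 2)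

theorem poissonKernel_circleMap (r θ t : ℝ) :
    poissonKernel 0 (circleMap 0 r θ) (circleMap 0 1 (t + θ)) = anglePoissonKernel r t := by
  have h : ‖circleMap 0 1 (t + θ) - circleMap 0 r θ‖ ^ 2 = 1 - 2 * r * Real.cos t + r ^ 2 := by
    rw [← Complex.normSq_eq_norm_sq, Complex.normSq_apply]
    have hc : Real.cos t = Real.cos (t + θ) * Real.cos θ + Real.sin (t + θ) * Real.sin θ := by
      rw [← Real.cos_sub, add_sub_cancel_right]
    simp only [circleMap_zero, Complex.sub_re, Complex.sub_im, Complex.mul_re, Complex.mul_im,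
      Complex.ofReal_re, Complex.ofReal_im, Complex.exp_ofReal_mul_I_re,
      Complex.exp_ofReal_mul_I_im]
    rw [hc]
    nlinarith [Real.sin_sq_add_cos_sq (t + θ), Real.sin_sq_add_cos_sq θ]
  rw [poissonKernel_def, anglePoissonKernel, sub_zero, sub_zero, h]
  simp

theorem anglePoissonKernel_denom_pos {r : ℝ} (h0 : 0 < r) (h1 : r < 1) (t : ℝ) :
    0 < 1 - 2 * r * Real.cos t + r ^ 2 := by
  nlinarith [Real.cos_le_one t, mul_le_mul_of_nonneg_left (Real.cos_le_one t) h0.le]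

/-- The derivative of the Poisson kernel in the angle. -/
noncomputable def anglePoissonKernelDeriv (r t : ℝ) : ℝ :=
  -((1 - r ^ 2) * (2 * r * Real.sin t)) / (1 - 2 * r * Real.cos t + r ^ 2) ^ 2

theorem hasDerivAt_anglePoissonKernel {r : ℝ} (h0 : 0 < r) (h1 : r < 1) (t : ℝ) :
    HasDerivAt (anglePoissonKernel r) (anglePoissonKernelDeriv r t) t := by
  have hD : HasDerivAt (fun t => 1 - 2 * r * Real.cos t + r ^ 2) (2 * r * Real.sin t) t := by
    have := (((Real.hasDerivAt_cos t).const_mul (2 * r)).const_sub 1).add_const (r ^ 2)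
    simpa using this
  have := (hasDerivAt_const t (1 - r ^ 2)).div hD (anglePoissonKernel_denom_pos h0 h1 t).ne'
  refine this.congr_deriv ?_
  rw [anglePoissonKernelDeriv]; ring

theorem continuous_anglePoissonKernelDeriv {r : ℝ} (h0 : 0 < r) (h1 : r < 1) :
    Continuous (anglePoissonKernelDeriv r) := by
  unfold anglePoissonKernelDeriv
  exact Continuous.div (by fun_prop) (by fun_prop) fun t =>
    pow_ne_zero 2 (anglePoissonKernel_denom_pos h0 h1 t).ne'

theorem continuous_anglePoissonKernel {r : ℝ} (h0 : 0 < r) (h1 : r < 1) :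
    Continuous (anglePoissonKernel r) :=
  continuous_iff_continuousAt.2 fun t => (hasDerivAt_anglePoissonKernel h0 h1 t).continuousAt

theorem poissonKernel_circleMap_periodic (r θ : ℝ) (G : ℝ → ℝ)
    (hG : Function.Periodic G (2 * Real.pi)) :
    ∫ t in (0 : ℝ)..2 * Real.pi, poissonKernel 0 (circleMap 0 r θ) (circleMap 0 1 t) * G t
      = ∫ t in -Real.pi..Real.pi, anglePoissonKernel r t * G (t + θ) := by
  have hper : Function.Periodic
      (fun t => poissonKernel 0 (circleMap 0 r θ) (circleMap 0 1 t) * G t) (2 * Real.pi) := by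
    intro t
    dsimp only
    rw [periodic_circleMap 0 1 t, hG t]
  have h1 := hper.intervalIntegral_add_eq 0 (-Real.pi + θ)
  rw [zero_add, show -Real.pi + θ + 2 * Real.pi = Real.pi + θ by ring] at h1
  rw [h1, ← intervalIntegral.integral_comp_add_right]
  simp_rw [poissonKernel_circleMap]

theorem integral_anglePoissonKernel {r : ℝ} (h0 : 0 < r) (h1 : r < 1) :
    ∫ t in -Real.pi..Real.pi, anglePoissonKernel r t = 2 * Real.pi := by
  have h := poissonKernel_circleMap_periodic r 0 (fun _ => 1) (fun _ => rfl)
  simp only [mul_one] at h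
  rw [← h]
  have hz : circleMap 0 r 0 ∈ Metric.ball (0 : ℂ) 1 := by simpa [abs_of_pos h0] using h1
  have h2 := DiffContOnCl.circleAverage_poissonKernel_smul (f := fun _ : ℂ => (1 : ℂ))
    diffContOnCl_const hz
  have h3 := congrArg Complex.re h2
  rw [Real.circleAverage_def] at h3
  simp only [Pi.smul_apply', Complex.real_smul, mul_one] at h3
  rw [intervalIntegral.integral_ofReal, ← Complex.ofReal_mul, Complex.ofReal_re, Complex.one_re] at h3
  have := Real.two_pi_pos
  field_simp at h3
  linarith

/-- The denominator is `(1 - r) ^ 2 + 2 r (1 - cos t)`, hence at least `2 r (1 - cos t)`, and `2 r ≤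
(2 r) ^ 2` once `r ≥ 1 / 2`. The weight `(1 - cos t) ^ 2` thus removes the singularity at `t = 0`.
-/
theorem abs_anglePoissonKernelDeriv_mul_le {r : ℝ} (h0 : 1 / 2 ≤ r) (h1 : r < 1) (t : ℝ) :
    |anglePoissonKernelDeriv r t| * (1 - Real.cos t) ^ 2 ≤ 1 - r ^ 2 := by
  have hr : 0 < r := by linarith
  have hD := anglePoissonKernel_denom_pos hr h1 t
  have hc : 0 ≤ 1 - Real.cos t := by linarith [Real.cos_le_one t]
  have hr2 : 0 < 1 - r ^ 2 := by nlinarith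
  have hs : |Real.sin t| ≤ 1 := Real.abs_sin_le_one t
  set D := 1 - 2 * r * Real.cos t + r ^ 2 with hDdef
  have hDc : 2 * r * (1 - Real.cos t) ≤ D := by nlinarith [sq_nonneg (1 - r)]
  have hDc2 : (2 * r * (1 - Real.cos t)) ^ 2 ≤ D ^ 2 := pow_le_pow_left₀ (by positivity) hDc 2
  rw [anglePoissonKernelDeriv, abs_div, abs_neg, abs_mul, abs_mul, abs_of_pos hr2,
    abs_of_pos (by positivity : 0 < 2 * r), abs_of_pos (by positivity : 0 < D ^ 2), div_mul_eq_mul_div,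
    div_le_iff₀ (by positivity)]
  have h3 : 2 * r * (1 - Real.cos t) ^ 2 ≤ D ^ 2 := by
    refine le_trans ?_ hDc2
    nlinarith [sq_nonneg (1 - Real.cos t)]
  calc (1 - r ^ 2) * (2 * r * |Real.sin t|) * (1 - Real.cos t) ^ 2
      ≤ (1 - r ^ 2) * (2 * r * 1) * (1 - Real.cos t) ^ 2 := by gcongr
    _ = (1 - r ^ 2) * (2 * r * (1 - Real.cos t) ^ 2) := by ring
    _ ≤ (1 - r ^ 2) * D ^ 2 := by gcongr

/-- The kernel decreases away from `t = 0`: `sin t` has the sign of `t` on this interval. -/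
theorem abs_mul_abs_anglePoissonKernelDeriv {r : ℝ} (h0 : 0 < r) (h1 : r < 1) {t : ℝ}
    (ht : t ∈ Set.Icc (-Real.pi) Real.pi) :
    |t| * |anglePoissonKernelDeriv r t| = -(t * anglePoissonKernelDeriv r t) := by
  rw [← abs_mul, abs_of_nonpos]
  have hr2 : 0 < 1 - r ^ 2 := by nlinarith
  have hts : 0 ≤ t * Real.sin t := by
    rcases le_total 0 t with h | h
    · exact mul_nonneg h (Real.sin_nonneg_of_nonneg_of_le_pi h ht.2)
    · exact mul_nonneg_of_nonpos_of_nonpos h (Real.sin_nonpos_of_nonpos_of_neg_pi_le h ht.1)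
  rw [anglePoissonKernelDeriv, mul_div_assoc']
  refine div_nonpos_of_nonpos_of_nonneg ?_ (by positivity)
  have : 0 ≤ (1 - r ^ 2) * (2 * r) * (t * Real.sin t) := by positivity
  linarith

theorem anglePoissonKernel_pi {r : ℝ} (h0 : 0 < r) (h1 : r < 1) :
    anglePoissonKernel r Real.pi = anglePoissonKernel r (-Real.pi) ∧
      0 ≤ anglePoissonKernel r Real.pi ∧ anglePoissonKernel r Real.pi ≤ 1 - r ^ 2 := by
  have hr2 : 0 < 1 - r ^ 2 := by nlinarith
  refine ⟨by simp [anglePoissonKernel], ?_, ?_⟩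
  · exact div_nonneg hr2.le (anglePoissonKernel_denom_pos h0 h1 _).le
  · refine div_le_self hr2.le ?_
    rw [Real.cos_pi]; nlinarith

/-- Integration by parts returns the total mass `2π` of the kernel, minus a nonnegative boundary
term. -/
theorem integral_neg_mul_anglePoissonKernelDeriv_le {r : ℝ} (h0 : 0 < r) (h1 : r < 1) :
    ∫ t in -Real.pi..Real.pi, -(t * anglePoissonKernelDeriv r t) ≤ 2 * Real.pi := by
  have h := intervalIntegral.integral_mul_deriv_eq_deriv_mul (a := -Real.pi) (b := Real.pi)
    (u := fun t => t) (u' := fun _ => 1)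
    (fun t _ => hasDerivAt_id' t) (fun t _ => hasDerivAt_anglePoissonKernel h0 h1 t)
    intervalIntegrable_const ((continuous_anglePoissonKernelDeriv h0 h1).intervalIntegrable _ _)
  simp only [one_mul] at h
  rw [integral_anglePoissonKernel h0 h1] at h
  rw [intervalIntegral.integral_neg, h]
  obtain ⟨h2, h3, -⟩ := anglePoissonKernel_pi h0 h1
  rw [← h2]
  nlinarith [Real.pi_pos]

/-- Near `0` the vanishing derivative gives `ε |t|`; away from `0`, `1 - cos t` is bounded below and
absorbs the bound of `E`. The two terms match the two estimates on the kernel's derivative. -/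
theorem exists_primitive_bound {E : ℝ → ℝ} (hc : ContinuousOn E (Set.Icc (-Real.pi) Real.pi))
    (h0 : E 0 = 0) (hd : HasDerivAt E 0 0) {ε : ℝ} (hε : 0 < ε) :
    ∃ M, 0 ≤ M ∧ ∀ t ∈ Set.Icc (-Real.pi) Real.pi,
      |E t| ≤ ε * |t| + M * (1 - Real.cos t) ^ 2 := by
  obtain ⟨B, hB⟩ := isCompact_Icc.exists_bound_of_continuousOn hc
  have hB0 : 0 ≤ B := (norm_nonneg _).trans (hB 0 ⟨by linarith [Real.pi_pos], Real.pi_pos.le⟩)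
  have ho := hasDerivAt_iff_isLittleO.1 hd
  simp only [h0, sub_zero, smul_zero] at ho
  obtain ⟨δ, hδ, hδE⟩ := Metric.eventually_nhds_iff.1 (ho.bound hε)
  simp only [dist_zero_right, Real.norm_eq_abs] at hδE hB
  set η := min δ Real.pi with hη
  have hη0 : 0 < η := lt_min hδ Real.pi_pos
  have hcos : 0 < 1 - Real.cos η := by
    have := Real.cos_lt_cos_of_nonneg_of_le_pi le_rfl (min_le_right δ Real.pi) hη0
    rw [Real.cos_zero] at this
    linarith
  refine ⟨B / (1 - Real.cos η) ^ 2, by positivity, fun t ht => ?_⟩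
  rcases lt_or_ge |t| δ with h | h
  · have : 0 ≤ B / (1 - Real.cos η) ^ 2 * (1 - Real.cos t) ^ 2 := by positivity
    linarith [hδE h]
  · have h1 : Real.cos t ≤ Real.cos η := by
      rw [← Real.cos_abs t]
      exact Real.cos_le_cos_of_nonneg_of_le_pi hη0.le (abs_le.2 ht) ((min_le_left _ _).trans h)
    have h2 : B ≤ B / (1 - Real.cos η) ^ 2 * (1 - Real.cos t) ^ 2 := by
      rw [div_mul_eq_mul_div, le_div_iff₀ (by positivity)]
      gcongr
    have : 0 ≤ ε * |t| := by positivity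
    linarith [hB t ht]

/-- Integrating by parts moves the derivative to the kernel, so only the primitive `E` of `H` has to
be small near `0`. -/
theorem tendsto_integral_anglePoissonKernel_mul {H : ℝ → ℝ}
    (hH : IntervalIntegrable H volume (-Real.pi) Real.pi)
    (hd : HasDerivAt (fun x => ∫ t in (0 : ℝ)..x, H t) 0 0) :
    Tendsto (fun r => ∫ t in -Real.pi..Real.pi, anglePoissonKernel r t * H t) (𝓝[<] 1) (𝓝 0) := by
  have hpi := Real.pi_pos
  have hle : -Real.pi ≤ Real.pi := by linarith
  have h0mem : (0 : ℝ) ∈ Set.uIcc (-Real.pi) Real.pi := by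
    rw [Set.uIcc_of_le hle]; exact ⟨by linarith, hpi.le⟩
  set E : ℝ → ℝ := fun x => ∫ t in (0 : ℝ)..x, H t with hE
  have hEac : AbsolutelyContinuousOnInterval E (-Real.pi) Real.pi :=
    hH.absolutelyContinuousOnInterval_intervalIntegral h0mem
  have hEc : ContinuousOn E (Set.Icc (-Real.pi) Real.pi) := by
    rw [← Set.uIcc_of_le hle]; exact hEac.continuousOn
  have hEd : ∀ᵐ t, t ∈ Set.uIcc (-Real.pi) Real.pi → deriv E t = H t := by
    filter_upwards [hH.ae_hasDerivAt_integral] with t ht hmem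
    exact (ht hmem 0 h0mem).deriv
  have key : ∀ ε > 0, ∃ K, 0 ≤ K ∧ ∀ r, 1 / 2 ≤ r → r < 1 →
      |∫ t in -Real.pi..Real.pi, anglePoissonKernel r t * H t|
        ≤ K * (1 - r ^ 2) + ε * (2 * Real.pi) := by
    intro ε hε
    obtain ⟨M, hM0, hM⟩ := exists_primitive_bound hEc (by simp [hE]) hd hε
    -- The first term pays for the boundary values at `±π`, the second for the part of `E` away from
    -- `0`.
    refine ⟨|E Real.pi - E (-Real.pi)| + M * (2 * Real.pi), by positivity, fun r hr h1 => ?_⟩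
    have hr0 : 0 < r := by linarith
    have hr2 : 0 < 1 - r ^ 2 := by nlinarith
    have hQac : AbsolutelyContinuousOnInterval (anglePoissonKernel r) (-Real.pi) Real.pi := by
      refine ContDiffOn.absolutelyContinuousOnInterval ?_
      refine ContDiff.contDiffOn ?_
      unfold anglePoissonKernel
      exact contDiff_const.div (by fun_prop) fun t => (anglePoissonKernel_denom_pos hr0 h1 t).ne'
    have hparts := hQac.integral_mul_deriv_eq_deriv_mul hEac
    have hL : ∫ t in -Real.pi..Real.pi, anglePoissonKernel r t * deriv E t
        = ∫ t in -Real.pi..Real.pi, anglePoissonKernel r t * H t := by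
      refine intervalIntegral.integral_congr_ae ?_
      filter_upwards [hEd] with t ht hmem
      rw [ht (Set.uIoc_subset_uIcc hmem)]
    have hderiv : deriv (anglePoissonKernel r) = anglePoissonKernelDeriv r :=
      funext fun t => (hasDerivAt_anglePoissonKernel hr0 h1 t).deriv
    obtain ⟨hQ1, hQ2, hQ3⟩ := anglePoissonKernel_pi hr0 h1
    rw [hL, hderiv, ← hQ1, ← mul_sub] at hparts
    have hQ'c := continuous_anglePoissonKernelDeriv hr0 h1
    have hbound : |∫ t in -Real.pi..Real.pi, anglePoissonKernelDeriv r t * E t|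
        ≤ ε * (2 * Real.pi) + M * (2 * Real.pi) * (1 - r ^ 2) := by
      have h2 : ‖∫ t in -Real.pi..Real.pi, anglePoissonKernelDeriv r t * E t‖
          ≤ ∫ t in -Real.pi..Real.pi,
            (ε * -(t * anglePoissonKernelDeriv r t) + M * (1 - r ^ 2)) := by
        refine intervalIntegral.norm_integral_le_of_norm_le hle ?_
          (Continuous.intervalIntegrable (by fun_prop) _ _)
        refine ae_of_all _ fun t ht => ?_
        have ht' : t ∈ Set.Icc (-Real.pi) Real.pi := Set.Ioc_subset_Icc_self ht
        rw [Real.norm_eq_abs, abs_mul, ← abs_mul_abs_anglePoissonKernelDeriv hr0 h1 ht']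
        calc |anglePoissonKernelDeriv r t| * |E t|
            ≤ |anglePoissonKernelDeriv r t| * (ε * |t| + M * (1 - Real.cos t) ^ 2) := by
              gcongr; exact hM t ht'
          _ = ε * (|t| * |anglePoissonKernelDeriv r t|)
              + M * (|anglePoissonKernelDeriv r t| * (1 - Real.cos t) ^ 2) := by ring
          _ ≤ _ := by
              gcongr
              exact abs_anglePoissonKernelDeriv_mul_le hr h1 t
      rw [intervalIntegral.integral_add (Continuous.intervalIntegrable (by fun_prop) _ _)
        intervalIntegrable_const, intervalIntegral.integral_const_mul,
        intervalIntegral.integral_const, smul_eq_mul, Real.norm_eq_abs] at h2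
      have h3 := mul_le_mul_of_nonneg_left (integral_neg_mul_anglePoissonKernelDeriv_le hr0 h1) hε.le
      linarith
    rw [hparts]
    refine (abs_sub _ _).trans ?_
    rw [abs_mul, abs_of_nonneg hQ2]
    have h4 := mul_le_mul_of_nonneg_right hQ3 (abs_nonneg (E Real.pi - E (-Real.pi)))
    linarith
  rw [Metric.tendsto_nhds]
  intro ε hε
  obtain ⟨K, hK0, hK⟩ := key (ε / (4 * Real.pi)) (by positivity)
  have hlim : Tendsto (fun r : ℝ => K * (1 - r ^ 2)) (𝓝[<] 1) (𝓝 (K * (1 - 1 ^ 2))) :=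
    Tendsto.mono_left (Continuous.tendsto (by fun_prop) 1) nhdsWithin_le_nhds
  have hev := hlim.eventually_lt_const (u := ε / 2) (by simpa using hε)
  filter_upwards [hev, Ioo_mem_nhdsLT (show (1 / 2 : ℝ) < 1 by norm_num)] with r h1 h2
  have h3 := hK r h2.1.le h2.2
  rw [dist_zero_right, Real.norm_eq_abs]
  have h4 : ε / (4 * Real.pi) * (2 * Real.pi) = ε / 2 := by field_simp; norm_num
  linarith

/-- **Fatou's theorem** for Poisson integrals of real functions. -/
theorem ae_tendsto_circleAverage_poissonKernel_mul {g : ℂ → ℝ} (hg : CircleIntegrable g 0 1) :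
    ∀ᵐ θ : ℝ, Tendsto (fun r : ℝ =>
        Real.circleAverage (fun ξ => poissonKernel 0 (circleMap 0 r θ) ξ * g ξ) 0 1)
      (𝓝[<] 1) (𝓝 (g (circleMap 0 1 θ))) := by
  have hpi := Real.pi_pos
  set G : ℝ → ℝ := fun t => g (circleMap 0 1 t) with hG
  have hper : Function.Periodic G (2 * Real.pi) := fun t => by
    simp only [hG, periodic_circleMap 0 1 t]
  have hint : ∀ a b, IntervalIntegrable G volume a b := fun a b =>
    hper.intervalIntegrable (t := 0) (by positivity) (by rw [zero_add]; exact hg) a b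
  have hloc : LocallyIntegrable G volume := by
    rw [locallyIntegrable_iff]
    intro k hk
    obtain ⟨R, hR⟩ := hk.isBounded.subset_closedBall 0
    rw [Real.closedBall_eq_Icc] at hR
    exact ((intervalIntegrable_iff' enorm_ne_top).1 (hint (0 - R) (0 + R))).mono_set (hR.trans Set.Icc_subset_uIcc)
  -- Lebesgue differentiation: at almost every `θ` the primitive of `G` has derivative `G θ`.
  -- Recentring at `θ` and subtracting `G θ` reduces to the previous lemma.
  filter_upwards [LocallyIntegrable.ae_hasDerivAt_integral hloc] with θ hθ
  set H : ℝ → ℝ := fun t => G (t + θ) - G θ with hH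
  have hGs : IntervalIntegrable (fun t => G (t + θ)) volume (-Real.pi) Real.pi := by
    have := (hint (-Real.pi + θ) (Real.pi + θ)).comp_add_right θ enorm_ne_top
    simpa using this
  have hHi : IntervalIntegrable H volume (-Real.pi) Real.pi := hGs.sub intervalIntegrable_const
  have hd : HasDerivAt (fun x => ∫ t in (0 : ℝ)..x, H t) 0 0 := by
    have h1 : (fun x => ∫ t in (0 : ℝ)..x, H t)
        = fun x => (∫ t in θ..(x + θ), G t) - x * G θ := by
      ext x
      have h2 : IntervalIntegrable (fun t => G (t + θ)) volume 0 x := by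
        have := (hint (0 + θ) (x + θ)).comp_add_right θ enorm_ne_top
        simpa using this
      rw [hH, intervalIntegral.integral_sub h2 intervalIntegrable_const,
        intervalIntegral.integral_comp_add_right]
      simp
    rw [h1]
    have h3 : HasDerivAt (fun x => ∫ t in θ..(x + θ), G t) (G θ) 0 := by
      have := hθ θ
      exact HasDerivAt.comp_add_const 0 θ (by simpa using this)
    have h4 := h3.sub ((hasDerivAt_id' (0 : ℝ)).mul_const (G θ))
    rw [one_mul, sub_self] at h4
    exact h4
  have hlim := ((tendsto_integral_anglePoissonKernel_mul hHi hd).const_mul (2 * Real.pi)⁻¹).add_const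
    (G θ)
  rw [mul_zero, zero_add] at hlim
  refine hlim.congr' ?_
  filter_upwards [Ioo_mem_nhdsLT (show (0 : ℝ) < 1 by norm_num)] with r hr
  have hQ := continuous_anglePoissonKernel hr.1 hr.2
  rw [Real.circleAverage_def, poissonKernel_circleMap_periodic r θ G hper, smul_eq_mul]
  have h5 : ∫ t in -Real.pi..Real.pi, anglePoissonKernel r t * H t
      = (∫ t in -Real.pi..Real.pi, anglePoissonKernel r t * G (t + θ)) - 2 * Real.pi * G θ := by
    rw [← integral_anglePoissonKernel hr.1 hr.2, ← intervalIntegral.integral_mul_const,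
      ← intervalIntegral.integral_sub (hGs.continuousOn_mul hQ.continuousOn)
        ((hQ.intervalIntegrable _ _).mul_const (G θ))]
    simp only [hH, mul_sub]
  rw [h5]
  field_simp
  ring

theorem circleIntegrable_poissonKernel_mul {g : ℂ → ℂ} (hg : CircleIntegrable g 0 1) {z : ℂ}
    (hz : ‖z‖ < 1) : CircleIntegrable (fun ξ => (poissonKernel 0 z ξ : ℂ) * g ξ) 0 1 := by
  refine hg.continuousOn_smul (g := fun ξ => (poissonKernel 0 z ξ : ℂ)) ?_
  refine Complex.continuous_ofReal.comp_continuousOn ?_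
  unfold poissonKernel
  refine ContinuousOn.div (by fun_prop) (by fun_prop) fun ξ hξ => ?_
  have := sub_ne_zero_of_norm_eq_one hz (ξ := ξ) (by simpa using hξ)
  simpa using this

/-- **Fatou's theorem** for Poisson integrals of complex functions. -/
theorem isRadialBoundaryFunction_poissonIntegral {g : ℂ → ℂ} (hg : CircleIntegrable g 0 1) :
    IsRadialBoundaryFunction (poissonIntegral g) g := by
  have hre : CircleIntegrable (fun ξ => (g ξ).re) 0 1 :=
    ⟨hg.1.re, hg.2.re⟩
  have him : CircleIntegrable (fun ξ => (g ξ).im) 0 1 :=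
    ⟨hg.1.im, hg.2.im⟩
  filter_upwards [ae_tendsto_circleAverage_poissonKernel_mul hre,
    ae_tendsto_circleAverage_poissonKernel_mul him] with θ h1 h2
  have h3 := (Complex.continuous_ofReal.tendsto _).comp h1
  have h4 := ((Complex.continuous_ofReal.tendsto _).comp h2).mul_const Complex.I
  have h5 := h3.add h4
  rw [Complex.re_add_im] at h5
  refine h5.congr' ?_
  filter_upwards [Ioo_mem_nhdsLT (show (0 : ℝ) < 1 by norm_num)] with r hr
  have hi := circleIntegrable_poissonKernel_mul hg (z := circleMap 0 r θ)
    (by simpa [abs_of_pos hr.1] using hr.2)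
  have h6 := Complex.reCLM.circleAverage_comp_comm hi
  have h7 := Complex.imCLM.circleAverage_comp_comm hi
  rw [← Complex.re_add_im (poissonIntegral g (circleMap 0 r θ))]
  simp only [Function.comp_def, Complex.reCLM_apply, Complex.imCLM_apply, Complex.re_ofReal_mul,
    Complex.im_ofReal_mul] at h6 h7 ⊢
  rw [h6, h7, poissonIntegral]

/-! ### Domination and congruence in the Hardy classes -/

theorem circleIntegrable_norm_sq_of_differentiableOn {f : ℂ → ℂ}
    (hf : DifferentiableOn ℂ f (Metric.ball 0 1)) {r : ℝ} (hr : r ∈ Set.Ioo (0 : ℝ) 1) :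
    CircleIntegrable (fun z => ‖f z‖ ^ 2) 0 r := by
  refine ContinuousOn.circleIntegrable hr.1.le (ContinuousOn.pow ?_ 2)
  exact (hf.continuousOn.mono (Metric.sphere_subset_ball hr.2)).norm

/-- An analytic function dominated by a function of `H²` belongs to `H²`. -/
theorem IsHardyTwo.of_norm_le {f g : ℂ → ℂ} (hf : IsHardyTwo f)
    (hg : DifferentiableOn ℂ g (Metric.ball 0 1)) {C : ℝ}
    (hC : ∀ z ∈ Metric.ball (0 : ℂ) 1, ‖g z‖ ≤ C * ‖f z‖) : IsHardyTwo g := by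
  obtain ⟨hd, M, hM⟩ := hf
  refine ⟨hg, C ^ 2 * M, ?_⟩
  rintro _ ⟨r, hr, rfl⟩
  have hi := circleIntegrable_norm_sq_of_differentiableOn hd hr
  have h1 : Real.circleAverage (fun z => ‖g z‖ ^ 2) 0 r
      ≤ Real.circleAverage (fun z => C ^ 2 • ‖f z‖ ^ 2) 0 r := by
    refine Real.circleAverage_mono (circleIntegrable_norm_sq_of_differentiableOn hg hr)
      hi.const_fun_smul fun z hz => ?_
    rw [smul_eq_mul, ← mul_pow]
    rw [abs_of_pos hr.1] at hz
    exact pow_le_pow_left₀ (norm_nonneg _) (hC z (Metric.sphere_subset_ball hr.2 hz)) 2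
  refine h1.trans ?_
  rw [Real.circleAverage_fun_smul, smul_eq_mul]
  exact mul_le_mul_of_nonneg_left (hM ⟨r, hr, rfl⟩) (sq_nonneg C)

theorem isHardyTwo_const (c : ℂ) : IsHardyTwo fun _ => c := by
  refine ⟨differentiableOn_const c, ‖c‖ ^ 2, ?_⟩
  rintro _ ⟨r, -, rfl⟩
  simp [Real.circleAverage_const]

theorem IsHardyInfty.isHardyTwo {f : ℂ → ℂ} (hf : IsHardyInfty f) : IsHardyTwo f := by
  obtain ⟨hd, M, hM⟩ := hf
  exact (isHardyTwo_const 1).of_norm_le hd (C := M) fun z hz => by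
    simpa using hM ⟨z, hz, rfl⟩

theorem isHardyInfty_of_norm_le {f : ℂ → ℂ} (hf : DifferentiableOn ℂ f (Metric.ball 0 1)) {C : ℝ}
    (hC : ∀ z ∈ Metric.ball (0 : ℂ) 1, ‖f z‖ ≤ C) : IsHardyInfty f :=
  ⟨hf, C, by rintro _ ⟨z, hz, rfl⟩; exact hC z hz⟩

theorem IsHardyInfty.congr {f g : ℂ → ℂ} (hf : IsHardyInfty f)
    (h : Set.EqOn g f (Metric.ball 0 1)) : IsHardyInfty g := by
  obtain ⟨hd, M, hM⟩ := hf
  exact isHardyInfty_of_norm_le (hd.congr h) fun z hz => by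
    rw [h hz]; exact hM ⟨z, hz, rfl⟩

theorem circleMap_zero_mem_ball {r : ℝ} (hr : r ∈ Set.Ioo (0 : ℝ) 1) (θ : ℝ) :
    circleMap 0 r θ ∈ Metric.ball (0 : ℂ) 1 := by
  simpa [abs_of_pos hr.1] using hr.2

theorem IsRadialBoundaryFunction.congr {f g φ : ℂ → ℂ} (hf : IsRadialBoundaryFunction f φ)
    (h : Set.EqOn g f (Metric.ball 0 1)) : IsRadialBoundaryFunction g φ := by
  filter_upwards [hf] with θ hθ
  refine hθ.congr' ?_
  filter_upwards [Ioo_mem_nhdsLT (show (0 : ℝ) < 1 by norm_num)] with r hr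
  exact (h (circleMap_zero_mem_ball hr θ)).symm

theorem IsOuter.congr {f g : ℂ → ℂ} (hf : IsOuter f) (h : Set.EqOn g f (Metric.ball 0 1)) :
    IsOuter g := by
  obtain ⟨hb, φ, hφ, h0, hi, he⟩ := hf
  exact ⟨hb.congr h, φ, hφ.congr h, h0, hi, fun z hz => by rw [h hz, he z hz]⟩

/-- Mean value inequality on the convex half-plane `re ≤ M`, where `|exp'| ≤ exp M`. -/
theorem Complex.norm_exp_sub_one_le_of_re_le {x : ℂ} {M : ℝ} (hM : 0 ≤ M) (hx : x.re ≤ M) :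
    ‖Complex.exp x - 1‖ ≤ Real.exp M * ‖x‖ := by
  have h := (convex_halfSpace_re_le M).norm_image_sub_le_of_norm_deriv_le (f := Complex.exp)
    (C := Real.exp M) (x := 0) (y := x) (fun _ _ => Complex.differentiable_exp _)
    (fun y hy => by
      rw [Complex.deriv_exp, Complex.norm_exp]
      exact Real.exp_le_exp.2 hy) (by simpa using hM) hx
  simpa using h

/-! ### Herglotz integrals and outer functions -/

/-- Real-valued version of the Poisson integral over the unit circle. -/
noncomputable def realPoissonIntegral (w : ℂ → ℝ) (z : ℂ) : ℝ :=
  Real.circleAverage (fun ξ => poissonKernel 0 z ξ * w ξ) 0 1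

theorem realPoissonIntegral_nonneg {w : ℂ → ℝ} (hw : ∀ ξ, 0 ≤ w ξ) {z : ℂ} (hz : ‖z‖ < 1) :
    0 ≤ realPoissonIntegral w z :=
  Real.circleAverage_nonneg_of_nonneg fun ξ hξ =>
    mul_nonneg (poissonKernel_nonneg hz (by simpa using hξ)) (hw ξ)

theorem norm_poissonIntegral_le (g : ℂ → ℂ) {z : ℂ} (hz : ‖z‖ < 1) :
    ‖poissonIntegral g z‖ ≤ realPoissonIntegral (fun ξ => ‖g ξ‖) z := by
  have hpi := Real.two_pi_pos
  rw [poissonIntegral, realPoissonIntegral, Real.circleAverage_def, Real.circleAverage_def,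
    norm_smul, norm_inv, Real.norm_of_nonneg hpi.le, smul_eq_mul]
  refine mul_le_mul_of_nonneg_left ?_ (by positivity)
  refine (intervalIntegral.norm_integral_le_integral_norm hpi.le).trans_eq ?_
  refine intervalIntegral.integral_congr fun θ _ => ?_
  simp only [norm_mul, Complex.norm_real]
  rw [Real.norm_of_nonneg (poissonKernel_nonneg hz (by simp))]

/-- The Herglotz integral of a real function over the unit circle. -/
noncomputable def herglotzIntegral (w : ℂ → ℝ) (z : ℂ) : ℂ :=
  Real.circleAverage (fun ξ => (ξ + z) / (ξ - z) * (w ξ : ℂ)) 0 1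

theorem re_herglotzIntegral {w : ℂ → ℝ} (hw : CircleIntegrable w 0 1) {z : ℂ}
    (hz : z ∈ Metric.ball (0 : ℂ) 1) : (herglotzIntegral w z).re = realPoissonIntegral w z := by
  have h := re_circleAverage_herglotzRieszKernel_smul hw hz
  rw [← poissonKernel_eq_re_herglotzRieszKernel] at h
  simpa [herglotzIntegral, realPoissonIntegral, herglotzRieszKernel_fun_def, Pi.mul_def] using h

/-- The exponential of minus a Herglotz integral, corrected by a polynomial, is outer. -/
theorem isOuter_exp_neg_herglotzIntegral_add {w : ℂ → ℝ} (hw : CircleIntegrable w 0 1)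
    (hw0 : ∀ ξ, 0 ≤ w ξ) {S : Polynomial ℂ} (hS : (S.eval 0).im = 0) {F : ℂ → ℂ}
    (hFd : DifferentiableOn ℂ F (Metric.ball 0 1))
    (hF : ∀ z ∈ Metric.ball (0 : ℂ) 1, F z = Complex.exp (-herglotzIntegral w z + S.eval z)) :
    IsOuter F := by
  have hnorm : ∀ z ∈ Metric.ball (0 : ℂ) 1,
      ‖F z‖ = Real.exp (-realPoissonIntegral w z + (S.eval z).re) := by
    intro z hz
    rw [hF z hz, Complex.norm_exp, Complex.add_re, Complex.neg_re, re_herglotzIntegral hw hz]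
  obtain ⟨M, hM⟩ := (isCompact_closedBall (0 : ℂ) 1).exists_bound_of_continuousOn
    S.continuous.continuousOn
  have hFb : IsHardyInfty F := by
    refine isHardyInfty_of_norm_le hFd (C := Real.exp M) fun z hz => ?_
    rw [hnorm z hz]
    refine Real.exp_le_exp.2 ?_
    have h1 := realPoissonIntegral_nonneg hw0 (z := z) (by simpa using hz)
    have h2 := (Complex.re_le_norm (S.eval z)).trans (hM z (Metric.ball_subset_closedBall hz))
    linarith
  obtain ⟨φ, hφm, hφL, hφ⟩ := hFb.isHardyTwo.exists_boundary
  have hφi : CircleIntegrable φ 0 1 :=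
    circleIntegrable_of_integrable hφm (hφL.integrable (by norm_num))
  have hrad : IsRadialBoundaryFunction F φ := by
    refine (isRadialBoundaryFunction_poissonIntegral hφi).congr fun z hz => ?_
    simpa using (hφ 1 z hz).symm
  -- Fatou's theorem for `w` gives the radial limit of `|F|`, which must agree with that of `F`
  -- itself.
  have hmod : ∀ᵐ θ : ℝ, ‖φ (circleMap 0 1 θ)‖
      = Real.exp (-w (circleMap 0 1 θ) + (S.eval (circleMap 0 1 θ)).re) := by
    filter_upwards [hrad, ae_tendsto_circleAverage_poissonKernel_mul hw] with θ h1 h2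
    have h3 : Tendsto (fun r : ℝ => (S.eval (circleMap 0 r θ)).re) (𝓝[<] 1)
        (𝓝 (S.eval (circleMap 0 1 θ)).re) := by
      refine Tendsto.mono_left (Continuous.tendsto ?_ 1) nhdsWithin_le_nhds
      unfold circleMap
      fun_prop
    have h4 := (Real.continuous_exp.tendsto _).comp (h2.neg.add h3)
    refine tendsto_nhds_unique h1.norm (h4.congr' ?_)
    filter_upwards [Ioo_mem_nhdsLT (show (0 : ℝ) < 1 by norm_num)] with r hr
    rw [hnorm _ (circleMap_zero_mem_ball hr θ)]
    rfl
  have hlog : ∀ᵐ θ : ℝ, Real.log ‖φ (circleMap 0 1 θ)‖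
      = -w (circleMap 0 1 θ) + (S.eval (circleMap 0 1 θ)).re := by
    filter_upwards [hmod] with θ h
    rw [h, Real.log_exp]
  have hSre : CircleIntegrable (fun ξ => (S.eval ξ).re) 0 1 :=
    (Complex.continuous_re.comp S.continuous).continuousOn.circleIntegrable zero_le_one
  refine ⟨hFb, φ, hrad, ?_, ?_, fun z hz => ?_⟩
  · filter_upwards [hmod] with θ h
    rw [← norm_ne_zero_iff, h]
    exact (Real.exp_pos _).ne'
  · have h : CircleIntegrable (fun ξ => -w ξ + (S.eval ξ).re) 0 1 := hw.neg.add hSre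
    refine IntervalIntegrable.congr_ae h ?_
    exact ae_restrict_of_ae (hlog.mono fun θ h => h.symm)
  · have hz' : ‖z‖ < 1 := by simpa using hz
    rw [hF z hz]
    congr 1
    have hwc : CircleIntegrable (fun ξ => (w ξ : ℂ)) 0 1 := ⟨hw.1.ofReal, hw.2.ofReal⟩
    have hSc : CircleIntegrable (fun ξ => ((S.eval ξ).re : ℂ)) 0 1 := ⟨hSre.1.ofReal, hSre.2.ofReal⟩
    have hker : ∀ {f : ℂ → ℂ}, CircleIntegrable f 0 1 →
        CircleIntegrable (fun ξ => (ξ + z) / (ξ - z) * f ξ) 0 1 := fun hf =>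
      circleIntegrable_div_sub_mul hf hz' (N := fun ξ => ξ + z) (by fun_prop)
    rw [herglotzIntegral, ← S.circleAverage_herglotz_re hS hz', neg_add_eq_sub,
      ← Real.circleAverage_fun_sub (hker hSc) (hker hwc), Real.circleAverage_def,
      Real.circleAverage_def]
    congr 1
    refine intervalIntegral.integral_congr_ae ?_
    filter_upwards [hlog] with θ h _
    rw [h]
    push_cast
    ring

/-! ### Construction of `u` and `v` -/

theorem theorem2 (p : Polynomial ℂ) (hp : ∀ z : ℂ, p.IsRoot z → ‖z‖ = 1)
    (h : ℂ → ℂ) (hh : IsHardyTwo h) :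
    ∃ u v : ℂ → ℂ, IsHardyTwo u ∧ IsHardyTwo v ∧
      IsHardyInfty (fun z => p.eval z * u z) ∧
      IsHardyInfty (fun z => p.eval z * v z) ∧
      IsOuter (fun z => p.eval z * v z + 1) ∧
      ∀ z ∈ Metric.ball (0 : ℂ) 1, h z = u z / (p.eval z * v z + 1) := by
  obtain ⟨g, hgm, hgL, hg⟩ := hh.exists_boundary
  set w : ℂ → ℝ := fun ξ => ‖p.eval ξ * g ξ‖ with hw
  set σ : ℂ → ℂ := fun ξ => (w ξ : ℂ) / p.eval ξ with hσ
  have hpm : Measurable fun ξ => p.eval ξ := p.continuous.measurable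
  have hwm : Measurable w := (hpm.mul hgm.measurable).norm
  have hσm : StronglyMeasurable σ :=
    ((Complex.measurable_ofReal.comp hwm).div hpm).stronglyMeasurable
  have hσL : MemLp σ 2 circleMeasure := by
    refine hgL.mono hσm.aestronglyMeasurable (ae_of_all _ fun ξ => ?_)
    simp only [hσ, hw, norm_div, Complex.norm_real, norm_norm, norm_mul]
    rcases eq_or_ne (p.eval ξ) 0 with h0 | h0
    · simp [h0]
    · rw [mul_div_cancel_left₀ _ (norm_ne_zero_iff.2 h0)]
  have hσi : CircleIntegrable σ 0 1 :=
    circleIntegrable_of_integrable hσm (hσL.integrable (by norm_num))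
  -- At zeros of `p` the quotient `σ` is `0` by convention, and `w` vanishes there too.
  have hpσ : ∀ ξ, p.eval ξ * σ ξ = w ξ := by
    intro ξ
    rcases eq_or_ne (p.eval ξ) 0 with h0 | h0
    · simp [hw, h0]
    · simp only [hσ]; field_simp
  have hwc : CircleIntegrable (fun ξ => (w ξ : ℂ)) 0 1 := by
    simp_rw [← hpσ]
    exact hσi.continuousOn_smul p.continuous.continuousOn
  have hwi : CircleIntegrable w 0 1 := by
    have : CircleIntegrable (fun ξ => ((w ξ : ℂ)).re) 0 1 := ⟨hwc.1.re, hwc.2.re⟩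
    simpa using this
  have hw0 : ∀ ξ, 0 ≤ w ξ := fun ξ => norm_nonneg _
  set k : ℂ → ℂ := fun z => Real.circleAverage (fun ξ => σ ξ / (ξ - z)) 0 1 with hk
  have hkH : IsHardyTwo k := isHardyTwo_cauchyIntegral hσm hσL
  obtain ⟨q, hq⟩ := p.exists_circleAverage_dividedDifference hσi
  -- The constant is the mean of the kernel's summand `1` against `w`; `2 z q` is the
  -- divided-difference part.
  set S : Polynomial ℂ := Polynomial.C ((Real.circleAverage w 0 1 : ℝ) : ℂ)
    + Polynomial.C 2 * Polynomial.X * q with hS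
  have hSe : ∀ z, S.eval z = (Real.circleAverage w 0 1 : ℝ) + 2 * z * q.eval z := by
    intro z; simp [hS]
  have hS0 : (S.eval 0).im = 0 := by rw [hSe]; simp
  have hW : ∀ z ∈ Metric.ball (0 : ℂ) 1,
      herglotzIntegral w z = S.eval z + 2 * z * (p.eval z * k z) := by
    intro z hz
    have hz' : ‖z‖ < 1 := by simpa using hz
    have hwavg : Real.circleAverage (fun ξ => (w ξ : ℂ)) 0 1
        = ((Real.circleAverage w 0 1 : ℝ) : ℂ) :=
      Complex.ofRealCLM.circleAverage_comp_comm hwi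
    have h1 : CircleIntegrable (fun ξ => (p.eval ξ - p.eval z) / (ξ - z) * σ ξ) 0 1 :=
      circleIntegrable_div_sub_mul hσi hz' (by fun_prop)
    have h2 : CircleIntegrable (fun ξ => p.eval z / (ξ - z) * σ ξ) 0 1 :=
      circleIntegrable_div_sub_mul hσi hz' continuous_const
    have h3 : Real.circleAverage (fun ξ => p.eval z / (ξ - z) * σ ξ) 0 1 = p.eval z * k z := by
      rw [hk, ← smul_eq_mul, ← Real.circleAverage_fun_smul]
      congr 1
      ext ξ
      rw [smul_eq_mul]; ring
    have h4 : herglotzIntegral w z = Real.circleAverage (fun ξ => (w ξ : ℂ)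
        + (2 * z) • ((p.eval ξ - p.eval z) / (ξ - z) * σ ξ + p.eval z / (ξ - z) * σ ξ)) 0 1 := by
      refine Real.circleAverage_congr_sphere fun ξ hξ => ?_
      have h5 := sub_ne_zero_of_norm_eq_one hz' (ξ := ξ) (by simpa using hξ)
      rw [smul_eq_mul, ← hpσ ξ]
      field_simp
      ring
    rw [h4, Real.circleAverage_fun_add hwc (h1.fun_add h2).const_fun_smul, Real.circleAverage_fun_smul,
      Real.circleAverage_fun_add h1 h2, hq z hz', h3, hwavg, hSe, smul_eq_mul]
    ring
  set F : ℂ → ℂ := fun z => Complex.exp (-(2 * z * (p.eval z * k z))) with hF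
  have hFd : DifferentiableOn ℂ F (Metric.ball 0 1) := by
    have hkd := hkH.1
    have hpd := p.differentiable.differentiableOn (s := Metric.ball 0 1)
    exact (((differentiableOn_id.const_mul 2).mul (hpd.mul hkd)).neg).cexp
  have hFW : ∀ z ∈ Metric.ball (0 : ℂ) 1,
      F z = Complex.exp (-herglotzIntegral w z + S.eval z) := by
    intro z hz
    rw [hW z hz, neg_add_rev, neg_add_cancel_right]
  have hFo : IsOuter F := isOuter_exp_neg_herglotzIntegral_add hwi hw0 hS0 hFd hFW
  obtain ⟨M, hM⟩ := (isCompact_closedBall (0 : ℂ) 1).exists_bound_of_continuousOn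
    S.continuous.continuousOn
  have hM0 : 0 ≤ M := (norm_nonneg _).trans (hM 0 (by simp))
  have hre : ∀ z ∈ Metric.ball (0 : ℂ) 1,
      (-(2 * z * (p.eval z * k z))).re ≤ -realPoissonIntegral w z + M := by
    intro z hz
    rw [show -(2 * z * (p.eval z * k z)) = -herglotzIntegral w z + S.eval z by rw [hW z hz]; ring,
      Complex.add_re, Complex.neg_re, re_herglotzIntegral hwi hz]
    have h2 := (Complex.re_le_norm (S.eval z)).trans (hM z (Metric.ball_subset_closedBall hz))
    linarith
  have hP0 : ∀ z ∈ Metric.ball (0 : ℂ) 1, 0 ≤ realPoissonIntegral w z := fun z hz =>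
    realPoissonIntegral_nonneg hw0 (by simpa using hz)
  have hFle : ∀ z ∈ Metric.ball (0 : ℂ) 1,
      ‖F z‖ ≤ Real.exp (-realPoissonIntegral w z) * Real.exp M := by
    intro z hz
    rw [hF, Complex.norm_exp, ← Real.exp_add]
    exact Real.exp_le_exp.2 (hre z hz)
  have hFb : ∀ z ∈ Metric.ball (0 : ℂ) 1, ‖F z‖ ≤ Real.exp M := by
    intro z hz
    refine (hFle z hz).trans (mul_le_of_le_one_left (Real.exp_pos M).le ?_)
    exact Real.exp_le_one_iff.2 (by linarith [hP0 z hz])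
  have hp0 : ∀ z ∈ Metric.ball (0 : ℂ) 1, p.eval z ≠ 0 := by
    intro z hz h0
    have hz' : ‖z‖ < 1 := by simpa using hz
    exact hz'.ne (hp z h0)
  have hpd : DifferentiableOn ℂ (fun z => p.eval z) (Metric.ball 0 1) :=
    p.differentiable.differentiableOn
  have hpv : ∀ z ∈ Metric.ball (0 : ℂ) 1, p.eval z * ((F z - 1) / p.eval z) = F z - 1 :=
    fun z hz => mul_div_cancel₀ _ (hp0 z hz)
  refine ⟨fun z => h z * F z, fun z => (F z - 1) / p.eval z, ?_, ?_, ?_, ?_, ?_, ?_⟩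
  · refine hh.of_norm_le (hh.1.mul hFd) (C := Real.exp M) fun z hz => ?_
    rw [norm_mul, mul_comm]
    exact mul_le_mul_of_nonneg_right (hFb z hz) (norm_nonneg _)
  -- The factor `p` in the exponent cancels the denominator, leaving a multiple of `k`.
  · refine hkH.of_norm_le ((hFd.sub_const 1).div hpd hp0) (C := Real.exp M * 2) fun z hz => ?_
    have hz' : ‖z‖ ≤ 1 := (show ‖z‖ < 1 by simpa using hz).le
    have h1 := Complex.norm_exp_sub_one_le_of_re_le hM0 ((hre z hz).trans
      (by linarith [hP0 z hz]))
    rw [norm_div, div_le_iff₀ (norm_pos_iff.2 (hp0 z hz))]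
    refine h1.trans ?_
    calc Real.exp M * ‖-(2 * z * (p.eval z * k z))‖
        = ‖z‖ * (Real.exp M * 2 * ‖k z‖ * ‖p.eval z‖) := by
          rw [norm_neg, norm_mul, norm_mul, norm_mul, Complex.norm_ofNat]; ring
      _ ≤ Real.exp M * 2 * ‖k z‖ * ‖p.eval z‖ := mul_le_of_le_one_left (by positivity) hz'
  · refine isHardyInfty_of_norm_le (hpd.mul (hh.1.mul hFd)) (C := Real.exp M) fun z hz => ?_
    have h1 : ‖p.eval z * h z‖ ≤ realPoissonIntegral w z := by
      rw [← hg p z hz]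
      exact norm_poissonIntegral_le _ (by simpa using hz)
    set x := realPoissonIntegral w z
    -- The decay of `F` compensates the growth of `p h`, both being controlled by the same Poisson
    -- integral.
    have h2 : x * Real.exp (-x) ≤ 1 := by
      rw [Real.exp_neg, ← div_eq_mul_inv, div_le_one (Real.exp_pos x)]
      linarith [Real.add_one_le_exp x]
    rw [← mul_assoc, norm_mul]
    calc ‖p.eval z * h z‖ * ‖F z‖ ≤ x * (Real.exp (-x) * Real.exp M) :=
          mul_le_mul h1 (hFle z hz) (norm_nonneg _) (hP0 z hz)
      _ = x * Real.exp (-x) * Real.exp M := by ring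
      _ ≤ Real.exp M := mul_le_of_le_one_left (Real.exp_pos M).le h2
  · refine IsHardyInfty.congr (f := fun z => F z - 1) ?_ hpv
    refine isHardyInfty_of_norm_le (hFd.sub_const 1) (C := Real.exp M + 1) fun z hz => ?_
    refine (norm_sub_le _ _).trans ?_
    rw [norm_one]
    linarith [hFb z hz]
  · refine hFo.congr fun z hz => ?_
    dsimp only
    rw [hpv z hz, sub_add_cancel]
  · intro z hz
    dsimp only
    rw [hpv z hz, sub_add_cancel, mul_div_cancel_right₀ _ (Complex.exp_ne_zero _)]
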